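/- Let $(\Omega,\Sigma,\mu)$ be a finite measure space, let $K$ be a compact Hausdorff space, and let $L_1(\mu)$ and $C(K)$ be the real Banach spaces of integrable functions on $\Omega$ (modulo equality almost everywhere) and of continuous functions on $K$ (with the supremum norm). A bounded linear operator $T:L_1(\mu)\to C(K)$ is called *Bochner representable* if there is a bounded strongly measurable function $h:\Omega\to C(K)$ such that $Tf=\int_\Omega f(\omega)h(\omega)\,d\mu(\omega)$ (Bochner integral) for every $f\in L_1(\mu)$, and *weakly compact* if it maps the closed unit ball of $L_1(\mu)$ to a relatively weakly compact subset of $C(K)$. Let $0<\varepsilon<1$. Suppose that $T:L_1(\mu)\to C(K)$ is a bounded linear operator with $\|T\|=1$ that is Bochner representable (respectively, weakly compact), and that $f\in L_1(\mu)$ satisfies $\|f\|=1$ and $\|Tf\|>1-\frac{\varepsilon^2}{6}$. Then there exist a Bochner representable (respectively, weakly compact) operator $S:L_1(\mu)\to C(K)$ with $\|S\|=1$ and a function $g\in L_1(\mu)$ with $\|g\|=1$ such that $$\|Sg\|=1,\qquad \|S-T\|<\varepsilon,\qquad \|f-g\|<\varepsilon .$$ -/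

import Mathlib

open MeasureTheory

/-- A bounded operator `T : L₁(μ) → X` into a Banach space is Bochner representable if there is a
bounded strongly measurable `g : Ω → X` with `T f = ∫ f(ω) g(ω) dμ(ω)` for all `f ∈ L₁(μ)`.
The integrand is always Bochner integrable, as `f` is integrable and `g` is bounded. Allowing `g`
to be bounded or measurable only up to a null set would define the same operators, because `g`
can be changed on a null set. -/
def IsBochnerRepresentable {Ω X : Type*} [MeasurableSpace Ω] {μ : Measure Ω}
    [NormedAddCommGroup X] [NormedSpace ℝ X] [CompleteSpace X]
    (T : Lp ℝ 1 μ →L[ℝ] X) : Prop :=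
  ∃ g : Ω → X, StronglyMeasurable g ∧ (∃ C : ℝ, ∀ ω, ‖g ω‖ ≤ C) ∧
    ∀ f : Lp ℝ 1 μ, T f = ∫ ω, f ω • g ω ∂μ

/-- A bounded operator is weakly compact if it maps the closed unit ball to a relatively
weakly compact set: the closure of the image in the weak topology is weakly compact. -/
def IsWeaklyCompactOperator {E X : Type*} [NormedAddCommGroup E] [NormedSpace ℝ E]
    [NormedAddCommGroup X] [NormedSpace ℝ X] (T : E →L[ℝ] X) : Prop :=
  IsCompact (closure (toWeakSpace ℝ X '' (T '' Metric.closedBall (0 : E) 1)))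

/-! Each t in K gives a functional f ↦ T f t with a density ρ_t bounded by 1. If |T f t₀| is almost
1, then ρ at t₀ must almost equal s = σ · sign f, with σ the sign of T f t₀, on a set A carrying
most of the mass of |f|. Replacing the density by s on a subset B of A makes the normalized
restriction g of f to B attain the norm at t₀. Values must stay continuous in t, so the change is
cut off by a continuous u with u(t₀) = 1: on B the new density is (1 - u(t)) ρ_t + u(t) s, a convex
combination, so the norm stays at most 1.

For S to be near T, ρ_t must be near ρ at t₀ on B for all t in the support of u. This is
`HasLocalEquicontinuityAt`, the only property of the two operator classes used to obtain the
estimates. Bochner representability gives it by separability of the range, weak compactness by an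
interchange of iterated limits. Exhaustion enlarges B to almost all of A, and `perturbation`
preserves both classes. -/

/-! ### Multiplication operators and densities of functionals on L₁. -/

section Multiplication

variable {Ω : Type*} [MeasurableSpace Ω] {μ : Measure Ω}

/-- Multiplication by an essentially bounded function, as an operator on `L₁(μ)`. -/
noncomputable def mulL1 (a : Lp ℝ ⊤ μ) : Lp ℝ 1 μ →L[ℝ] Lp ℝ 1 μ :=
  (ContinuousLinearMap.mul ℝ ℝ).holderL μ ⊤ 1 1 a

theorem coeFn_mulL1 (a : Lp ℝ ⊤ μ) (f : Lp ℝ 1 μ) :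
    mulL1 a f =ᵐ[μ] fun ω => a ω * f ω :=
  (ContinuousLinearMap.mul ℝ ℝ).coeFn_holder (r := 1) a f

/-- Integration against an essentially bounded function, as a functional on `L₁(μ)`. -/
noncomputable def pairL1 (b : Lp ℝ ⊤ μ) : Lp ℝ 1 μ →L[ℝ] ℝ :=
  (ContinuousLinearMap.mul ℝ ℝ).lpPairing μ ⊤ 1 b

theorem pairL1_apply (b : Lp ℝ ⊤ μ) (f : Lp ℝ 1 μ) :
    pairL1 b f = ∫ ω, b ω * f ω ∂μ :=
  (ContinuousLinearMap.mul ℝ ℝ).lpPairing_eq_integral b f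

theorem exists_bounded_measurable_ae_eq (a : Lp ℝ ⊤ μ) :
    ∃ a' : Ω → ℝ, Measurable a' ∧ (∃ C, ∀ ω, |a' ω| ≤ C) ∧ a =ᵐ[μ] a' := by
  obtain ⟨C, hC⟩ : ∃ C : ℝ, ∀ᵐ ω ∂μ, |a ω| ≤ C :=
    ⟨(eLpNormEssSup a μ).toReal, by
      filter_upwards [ae_le_eLpNormEssSup (f := a) (μ := μ)] with ω hω
      have htop : eLpNormEssSup a μ ≠ ⊤ := by
        rw [← eLpNorm_exponent_top]; exact Lp.eLpNorm_ne_top a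
      simpa using ENNReal.toReal_mono htop hω⟩
  refine ⟨fun ω => max (-|C|) (min |C| (a ω)), ?_, ⟨|C|, fun ω => ?_⟩, ?_⟩
  · have := (Lp.stronglyMeasurable a).measurable
    fun_prop
  · rw [abs_le]
    exact ⟨le_max_left _ _, max_le (by linarith [abs_nonneg C]) (min_le_left _ _)⟩
  · filter_upwards [hC] with ω hω
    have := abs_le.1 (hω.trans (le_abs_self C))
    rw [min_eq_right this.2, max_eq_right this.1]

/-- Since μ is finite, L₂ maps into L₁, and Riesz representation in L₂ supplies the density p.
Testing on indicators bounds p by ‖l‖ almost everywhere; density of simple functions extends the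
formula to L₁. -/
theorem exists_density [IsFiniteMeasure μ] (l : Lp ℝ 1 μ →L[ℝ] ℝ) :
    ∃ ρ : Ω → ℝ, Measurable ρ ∧ (∀ ω, |ρ ω| ≤ ‖l‖) ∧
      ∀ f : Lp ℝ 1 μ, l f = ∫ ω, f ω * ρ ω ∂μ := by
  have one2 : MemLp (fun _ : Ω => (1 : ℝ)) 2 μ := memLp_const 1
  let ι : Lp ℝ 2 μ →L[ℝ] Lp ℝ 1 μ :=
    (ContinuousLinearMap.mul ℝ ℝ).holderL μ 2 2 1 one2.toLp
  have hι : ∀ f : Lp ℝ 2 μ, ι f =ᵐ[μ] f := fun f => by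
    have h1 := (ContinuousLinearMap.mul ℝ ℝ).coeFn_holder (r := 1) one2.toLp f
    filter_upwards [h1, one2.coeFn_toLp] with ω h1 h2
    refine h1.trans ?_
    rw [h2, ContinuousLinearMap.mul_apply', one_mul]
  let p : Lp ℝ 2 μ := (InnerProductSpace.toDual ℝ (Lp ℝ 2 μ)).symm (l.comp ι)
  have hp : ∀ f : Lp ℝ 2 μ, l (ι f) = ∫ ω, f ω * p ω ∂μ := fun f => by
    have : inner ℝ p f = (l.comp ι) f := InnerProductSpace.toDual_symm_apply
    rw [L2.inner_def] at this
    rw [← ContinuousLinearMap.comp_apply, ← this]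
    rfl
  have hpint : Integrable p μ := (Lp.memLp p).integrable (by norm_num)
  have hind : ∀ {F : Set Ω} (hF : MeasurableSet F),
      l (indicatorConstLp 1 hF (measure_ne_top μ F) 1) = ∫ ω in F, p ω ∂μ := fun {F} hF => by
    have : indicatorConstLp 1 hF (measure_ne_top μ F) (1 : ℝ) =
        ι (indicatorConstLp 2 hF (measure_ne_top μ F) 1) := by
      apply Lp.ext
      filter_upwards [hι (indicatorConstLp 2 hF (measure_ne_top μ F) 1),
        indicatorConstLp_coeFn (p := 1) (hs := hF) (hμs := measure_ne_top μ F) (c := (1 : ℝ)),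
        indicatorConstLp_coeFn (p := 2) (hs := hF) (hμs := measure_ne_top μ F) (c := (1 : ℝ))]
        with ω h1 h2 h3
      rw [h1, h2, h3]
    rw [this, hp, ← integral_indicator hF]
    apply integral_congr_ae
    filter_upwards [indicatorConstLp_coeFn (p := 2) (hs := hF)
      (hμs := measure_ne_top μ F) (c := (1 : ℝ))] with ω h3
    rw [h3]
    by_cases h : ω ∈ F <;> simp [h]
  have hbd : ∀ F : Set Ω, MeasurableSet F → |∫ ω in F, p ω ∂μ| ≤ ‖l‖ * μ.real F := fun F hF => by
    rw [← hind hF]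
    refine (l.le_opNorm _).trans ?_
    rw [norm_indicatorConstLp (by norm_num) (by norm_num)]
    simp
  have hle : ∀ᵐ ω ∂μ, |p ω| ≤ ‖l‖ := by
    have h1 : p ≤ᵐ[μ] fun _ => ‖l‖ :=
      ae_le_of_forall_setIntegral_le hpint (integrable_const _) fun F hF _ => by
        rw [setIntegral_const, smul_eq_mul, mul_comm]
        exact (abs_le.1 (hbd F hF)).2
    have h2 : (fun _ => -‖l‖) ≤ᵐ[μ] p :=
      ae_le_of_forall_setIntegral_le (integrable_const _) hpint fun F hF _ => by
        rw [setIntegral_const, smul_eq_mul, mul_comm, neg_mul]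
        exact (abs_le.1 (hbd F hF)).1
    filter_upwards [h1, h2] with ω h1 h2 using abs_le.2 ⟨h2, h1⟩
  have hpm := (Lp.stronglyMeasurable p).measurable
  have hpL : MemLp p ⊤ μ := memLp_top_of_bound hpm.aestronglyMeasurable _ hle
  have hl : ∀ f : Lp ℝ 1 μ, l f = ∫ ω, f ω * p ω ∂μ := by
    suffices l = pairL1 hpL.toLp by
      intro f
      rw [this, pairL1_apply]
      apply integral_congr_ae
      filter_upwards [hpL.coeFn_toLp] with ω h
      rw [h, mul_comm]
    ext f
    induction f using Lp.induction ENNReal.one_ne_top with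
    | @indicatorConst c F hF hμF =>
      have : (Lp.simpleFunc.indicatorConst 1 hF hμF.ne c : Lp ℝ 1 μ)
          = c • indicatorConstLp 1 hF hμF.ne (1 : ℝ) := by
        rw [Lp.simpleFunc.coe_indicatorConst]
        apply Lp.ext
        filter_upwards [Lp.coeFn_smul c (indicatorConstLp 1 hF hμF.ne (1 : ℝ)),
          indicatorConstLp_coeFn (p := 1) (hs := hF) (hμs := hμF.ne) (c := (1 : ℝ)),
          indicatorConstLp_coeFn (p := 1) (hs := hF) (hμs := hμF.ne) (c := c)] with ω h1 h2 h3
        rw [h1, h3, Pi.smul_apply, h2]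
        by_cases h : ω ∈ F <;> simp [h]
      rw [this, map_smul, map_smul, hind hF, pairL1_apply, ← integral_indicator hF]
      congr 1
      apply integral_congr_ae
      filter_upwards [hpL.coeFn_toLp, indicatorConstLp_coeFn (p := 1) (hs := hF)
        (hμs := hμF.ne) (c := (1 : ℝ))] with ω h1 h2
      rw [h1, h2]
      by_cases h : ω ∈ F <;> simp [h]
    | add hf hg _ h1 h2 => rw [map_add, map_add, h1, h2]
    | isClosed => exact isClosed_eq l.continuous (pairL1 _).continuous
  -- Truncation makes the bound hold at every point rather than almost everywhere.
  refine ⟨fun ω => max (-‖l‖) (min ‖l‖ (p ω)), by fun_prop, fun ω => ?_, fun f => ?_⟩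
  · rw [abs_le]
    exact ⟨le_max_left _ _, max_le (by linarith [norm_nonneg l]) (min_le_left _ _)⟩
  · rw [hl]
    apply integral_congr_ae
    filter_upwards [hle] with ω h
    have := abs_le.1 h
    rw [min_eq_right this.2, max_eq_right this.1]

end Multiplication

/-! ### Stability of weakly compact operators. -/

section WeakCompactness

variable {E F X Y : Type*} [NormedAddCommGroup E] [NormedSpace ℝ E]
  [NormedAddCommGroup F] [NormedSpace ℝ F]
  [NormedAddCommGroup X] [NormedSpace ℝ X] [NormedAddCommGroup Y] [NormedSpace ℝ Y]

theorem isWeaklyCompactOperator_iff (T : E →L[ℝ] X) :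
    IsWeaklyCompactOperator T ↔ ∃ C : Set (WeakSpace ℝ X), IsCompact C ∧
      ∀ x, ‖x‖ ≤ 1 → toWeakSpace ℝ X (T x) ∈ C := by
  constructor
  · intro h
    refine ⟨_, h, fun x hx => subset_closure ⟨_, ⟨x, by simpa using hx, rfl⟩, rfl⟩⟩
  · rintro ⟨C, hC, h⟩
    refine hC.closure_of_subset ?_
    rintro _ ⟨_, ⟨x, hx, rfl⟩, rfl⟩
    exact h x (by simpa using hx)

theorem IsWeaklyCompactOperator.add {S T : E →L[ℝ] X} (hS : IsWeaklyCompactOperator S)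
    (hT : IsWeaklyCompactOperator T) : IsWeaklyCompactOperator (S + T) := by
  rw [isWeaklyCompactOperator_iff] at *
  obtain ⟨C, hC, h1⟩ := hS
  obtain ⟨D, hD, h2⟩ := hT
  exact ⟨(fun z => z.1 + z.2) '' C ×ˢ D, (hC.prod hD).image continuous_add,
    fun x hx => ⟨(_, _), ⟨h1 x hx, h2 x hx⟩, rfl⟩⟩

theorem IsWeaklyCompactOperator.comp_left {T : E →L[ℝ] X} (hT : IsWeaklyCompactOperator T)
    (R : X →L[ℝ] Y) : IsWeaklyCompactOperator (R.comp T) := by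
  rw [isWeaklyCompactOperator_iff] at *
  obtain ⟨C, hC, h1⟩ := hT
  exact ⟨WeakSpace.map R '' C, hC.image (WeakSpace.map R).continuous,
    fun x hx => ⟨_, h1 x hx, rfl⟩⟩

theorem IsWeaklyCompactOperator.comp_right {T : E →L[ℝ] X} (hT : IsWeaklyCompactOperator T)
    (R : F →L[ℝ] E) : IsWeaklyCompactOperator (T.comp R) := by
  rw [isWeaklyCompactOperator_iff] at *
  obtain ⟨C, hC, h1⟩ := hT
  -- Scaling by ‖R‖ + 1 instead of ‖R‖ covers R = 0.
  refine ⟨(fun y => (‖R‖ + 1) • y) '' C, hC.image (continuous_const_smul _), fun x hx => ?_⟩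
  have hpos : 0 < ‖R‖ + 1 := by positivity
  refine ⟨_, h1 ((‖R‖ + 1)⁻¹ • R x) ?_, ?_⟩
  · rw [norm_smul, norm_inv, Real.norm_of_nonneg hpos.le, inv_mul_le_iff₀ hpos]
    have := R.le_opNorm x
    nlinarith [norm_nonneg R]
  · simp only [map_smul]
    rw [smul_smul, mul_inv_cancel₀ hpos.ne', one_smul]
    rfl

theorem isWeaklyCompactOperator_smulRight (l : E →L[ℝ] ℝ) (y : X) :
    IsWeaklyCompactOperator (l.smulRight y) := by
  rw [isWeaklyCompactOperator_iff]
  refine ⟨(fun c : ℝ => c • toWeakSpace ℝ X y) '' Set.Icc (-‖l‖) ‖l‖,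
    isCompact_Icc.image (by fun_prop), fun x hx => ⟨l x, ?_, by simp⟩⟩
  rw [Set.mem_Icc, ← abs_le]
  exact l.le_of_opNorm_le_of_le le_rfl hx |>.trans (by simp)

end WeakCompactness

/-! ### Local equicontinuity of the densities. -/

section LocalEquicontinuity

open Filter Topology

variable {Ω K : Type*} [MeasurableSpace Ω] {μ : Measure Ω} [IsFiniteMeasure μ]
  [TopologicalSpace K]

/-- The density representing the functional `f ↦ T f t` on `L₁(μ)`. -/
noncomputable def evalDensity (T : Lp ℝ 1 μ →L[ℝ] C(K, ℝ)) (t : K) : Ω → ℝ :=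
  (exists_density ((ContinuousMap.evalCLM ℝ t).comp T)).choose

theorem measurable_evalDensity (T : Lp ℝ 1 μ →L[ℝ] C(K, ℝ)) (t : K) :
    Measurable (evalDensity T t) :=
  (exists_density ((ContinuousMap.evalCLM ℝ t).comp T)).choose_spec.1

theorem apply_eq_integral_evalDensity (T : Lp ℝ 1 μ →L[ℝ] C(K, ℝ)) (t : K) (f : Lp ℝ 1 μ) :
    T f t = ∫ ω, f ω * evalDensity T t ω ∂μ :=
  (exists_density ((ContinuousMap.evalCLM ℝ t).comp T)).choose_spec.2.2 f

theorem apply_indicatorConstLp (T : Lp ℝ 1 μ →L[ℝ] C(K, ℝ)) (t : K) {F : Set Ω}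
    (hF : MeasurableSet F) :
    T (indicatorConstLp 1 hF (measure_ne_top μ F) 1) t = ∫ ω in F, evalDensity T t ω ∂μ := by
  rw [apply_eq_integral_evalDensity, ← integral_indicator hF]
  apply integral_congr_ae
  filter_upwards [indicatorConstLp_coeFn (p := 1) (hs := hF)
    (hμs := measure_ne_top μ F) (c := (1 : ℝ))] with ω h
  rw [h]
  by_cases h : ω ∈ F <;> simp [h]

variable [CompactSpace K]

theorem abs_evalDensity_le (T : Lp ℝ 1 μ →L[ℝ] C(K, ℝ)) (t : K) (ω : Ω) :
    |evalDensity T t ω| ≤ ‖T‖ := by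
  refine ((exists_density ((ContinuousMap.evalCLM ℝ t).comp T)).choose_spec.2.1 ω).trans ?_
  refine ContinuousLinearMap.opNorm_le_bound _ T.opNorm_nonneg fun f => ?_
  exact ((T f).norm_coe_le_norm t).trans (T.le_opNorm f)

theorem integrable_evalDensity (T : Lp ℝ 1 μ →L[ℝ] C(K, ℝ)) (t : K) :
    Integrable (evalDensity T t) μ :=
  Integrable.of_bound (measurable_evalDensity T t).aestronglyMeasurable ‖T‖
    (.of_forall (abs_evalDensity_le T t))

/-- The normalized indicator function of `F`. -/
noncomputable def normalizedIndicator (μ : Measure Ω) [IsFiniteMeasure μ] (F : Set Ω)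
    (hF : MeasurableSet F) : Lp ℝ 1 μ :=
  (μ.real F)⁻¹ • indicatorConstLp 1 hF (measure_ne_top μ F) 1

theorem norm_normalizedIndicator_le {F : Set Ω} (hF : MeasurableSet F) :
    ‖normalizedIndicator μ F hF‖ ≤ 1 := by
  rw [normalizedIndicator, norm_smul, norm_indicatorConstLp (by norm_num) (by norm_num)]
  simpa [abs_of_nonneg] using inv_mul_le_one

/-- Every non-null set has a non-null subset on which the densities of `T` at points near `t₀` are
uniformly close to the density at `t₀`. -/
def HasLocalEquicontinuityAt (T : Lp ℝ 1 μ →L[ℝ] C(K, ℝ)) (t₀ : K) : Prop :=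
  ∀ E : Set Ω, MeasurableSet E → μ E ≠ 0 → ∀ r : ℝ, 0 < r →
    ∃ B ⊆ E, MeasurableSet B ∧ μ B ≠ 0 ∧ ∃ U ∈ 𝓝 t₀, ∀ t ∈ U,
      ∀ᵐ ω ∂μ, ω ∈ B → |evalDensity T t ω - evalDensity T t₀ ω| ≤ r

theorem evalDensity_ae_eq_of_forall_apply_eq_integral {T : Lp ℝ 1 μ →L[ℝ] C(K, ℝ)}
    {h : Ω → C(K, ℝ)} (hm : StronglyMeasurable h) {C : ℝ} (hC : ∀ ω, ‖h ω‖ ≤ C)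
    (hT : ∀ f : Lp ℝ 1 μ, T f = ∫ ω, f ω • h ω ∂μ) (t : K) :
    evalDensity T t =ᵐ[μ] fun ω => h ω t := by
  have hint : Integrable h μ := Integrable.of_bound hm.aestronglyMeasurable C (.of_forall hC)
  refine Integrable.ae_eq_of_forall_setIntegral_eq _ _ (integrable_evalDensity T t)
    ((ContinuousMap.evalCLM ℝ t).integrable_comp hint) fun F hF _ => ?_
  rw [← apply_indicatorConstLp T t hF, hT]
  have : ∫ ω, (indicatorConstLp 1 hF (measure_ne_top μ F) (1 : ℝ) : Lp ℝ 1 μ) ω • h ω ∂μ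
      = ∫ ω in F, h ω ∂μ := by
    rw [← integral_indicator hF]
    apply integral_congr_ae
    filter_upwards [indicatorConstLp_coeFn (p := 1) (hs := hF)
      (hμs := measure_ne_top μ F) (c := (1 : ℝ))] with ω h
    rw [h]
    by_cases h : ω ∈ F <;> simp [h]
  rw [this]
  exact ((ContinuousMap.evalCLM ℝ t).integral_comp_comm hint.integrableOn).symm

theorem IsBochnerRepresentable.hasLocalEquicontinuityAt {T : Lp ℝ 1 μ →L[ℝ] C(K, ℝ)}
    (hT : IsBochnerRepresentable T) (t₀ : K) : HasLocalEquicontinuityAt T t₀ := by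
  obtain ⟨h, hm, ⟨C, hC⟩, hT⟩ := hT
  intro E hE hμE r hr
  obtain ⟨c, hc, hcl⟩ := hm.isSeparable_range
  -- Countably many balls cover the range of h, so one has non-null preimage in E. There h is
  -- uniformly near its centre x, and continuity of x at t₀ gives U.
  obtain ⟨x, -, hx⟩ : ∃ x ∈ c, μ (E ∩ h ⁻¹' Metric.ball x (r / 4)) ≠ 0 := by
    by_contra! H
    refine hμE (measure_mono_null ?_ ((measure_biUnion_null_iff hc).2 H))
    intro ω hω
    obtain ⟨x, hx, hd⟩ := Metric.mem_closure_iff.1 (hcl ⟨ω, rfl⟩) (r / 4) (by positivity)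
    exact Set.mem_biUnion hx ⟨hω, hd⟩
  refine ⟨_, Set.inter_subset_left, hE.inter
    ((hm.dist stronglyMeasurable_const).measurable measurableSet_Iio), hx,
    {t | |x t - x t₀| < r / 2}, ?_, fun t ht => ?_⟩
  · exact (isOpen_lt (by fun_prop) (by fun_prop)).mem_nhds (by simpa using hr)
  · filter_upwards [evalDensity_ae_eq_of_forall_apply_eq_integral hm hC hT t,
      evalDensity_ae_eq_of_forall_apply_eq_integral hm hC hT t₀] with ω h1 h2 hω
    rw [h1, h2]
    have h3 := ((h ω).dist_apply_le_dist t).trans_lt hω.2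
    have h4 := ((h ω).dist_apply_le_dist t₀).trans_lt hω.2
    rw [Real.dist_eq, abs_lt] at h3 h4
    have h5 := abs_lt.1 (show |x t - x t₀| < r / 2 from ht)
    rw [abs_le]
    constructor <;> linarith

/-- On a non-null part of B the difference of densities is above r, or on one it is below -r. With
the sign fixed, no average over a smaller set can cancel; this heredity is what a decreasing
construction needs. -/
theorem exists_apply_normalizedIndicator_ge {T : Lp ℝ 1 μ →L[ℝ] C(K, ℝ)} {t t₀ : K} {B : Set Ω}
    (hB : MeasurableSet B) {r : ℝ}
    (h : ¬ ∀ᵐ ω ∂μ, ω ∈ B → |evalDensity T t ω - evalDensity T t₀ ω| ≤ r) :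
    ∃ B' ⊆ B, MeasurableSet B' ∧ μ B' ≠ 0 ∧ ∀ (F : Set Ω) (hF : MeasurableSet F), F ⊆ B' →
      μ F ≠ 0 →
      r ≤ |T (normalizedIndicator μ F hF) t - T (normalizedIndicator μ F hF) t₀| := by
  set d : Ω → ℝ := fun ω => evalDensity T t ω - evalDensity T t₀ ω
  have hd : Measurable d := (measurable_evalDensity T t).sub (measurable_evalDensity T t₀)
  have hdi : Integrable d μ := (integrable_evalDensity T t).sub (integrable_evalDensity T t₀)
  have key : ∀ (F : Set Ω) (hF : MeasurableSet F),
      T (normalizedIndicator μ F hF) t - T (normalizedIndicator μ F hF) t₀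
        = (μ.real F)⁻¹ * ∫ ω in F, d ω ∂μ := fun F hF => by
    rw [integral_sub (integrable_evalDensity T t).integrableOn
      (integrable_evalDensity T t₀).integrableOn, ← apply_indicatorConstLp T t hF,
      ← apply_indicatorConstLp T t₀ hF, normalizedIndicator, map_smul]
    simp [mul_sub]
  have hpos : ∀ F : Set Ω, μ F ≠ 0 → 0 < μ.real F := fun F hF =>
    ENNReal.toReal_pos hF (measure_ne_top μ F)
  by_cases hp : μ (B ∩ {ω | r < d ω}) = 0
  · have hn : μ (B ∩ {ω | d ω < -r}) ≠ 0 := by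
      intro hn
      refine h (measure_mono_null ?_ (measure_union_null hp hn))
      intro ω hω
      simp only [Set.mem_compl_iff, Set.mem_ofPred_eq, Classical.not_imp, not_le, lt_abs] at hω
      rcases hω.2 with h | h
      · exact Or.inl ⟨hω.1, h⟩
      · exact Or.inr ⟨hω.1, by simp only [Set.mem_ofPred_eq, d]; linarith⟩
    refine ⟨_, Set.inter_subset_left, hB.inter (measurableSet_lt hd measurable_const), hn,
      fun F hF hFB hμF => ?_⟩
    rw [key, le_abs, ← mul_neg]
    right
    rw [← div_eq_inv_mul, le_div_iff₀ (hpos F hμF)]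
    have := setIntegral_mono_on hdi.integrableOn (integrable_const (-r)).integrableOn hF
      fun ω hω => (hFB hω).2.le
    rw [setIntegral_const, smul_eq_mul] at this
    linarith
  · refine ⟨_, Set.inter_subset_left, hB.inter (measurableSet_lt measurable_const hd), hp,
      fun F hF hFB hμF => ?_⟩
    rw [key, le_abs]
    left
    rw [← div_eq_inv_mul, le_div_iff₀ (hpos F hμF)]
    have := setIntegral_mono_on (integrable_const r).integrableOn hdi.integrableOn hF
      fun ω hω => (hFB hω).2.le
    rw [setIntegral_const, smul_eq_mul] at this
    linarith

/-- Along a relatively weakly compact sequence, limits in the index and in the point of `K` can be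
interchanged. -/
theorem false_of_separated_iterated_limits {C : Set (WeakSpace ℝ C(K, ℝ))} (hC : IsCompact C)
    {x : ℕ → C(K, ℝ)} (hx : ∀ n, toWeakSpace ℝ C(K, ℝ) (x n) ∈ C) {t : ℕ → K} {t₀ : K} {r : ℝ}
    (hr : 0 < r) (hlow : ∀ m n, m ≤ n → r ≤ |x n (t m) - x n t₀|)
    (hup : ∀ n m, n < m → |x n (t m) - x n t₀| ≤ 1 / ((n : ℝ) + 1)) : False := by
  -- K need not be sequentially compact, so limits are taken along one free ultrafilter.
  let 𝒰 : Ultrafilter ℕ := hyperfilter ℕ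
  have h𝒰 : ∀ n : ℕ, ∀ᶠ m in (𝒰 : Filter ℕ), n < m := fun n =>
    Nat.hyperfilter_le_atTop (eventually_gt_atTop n)
  obtain ⟨y, -, hy⟩ := hC.ultrafilter_le_nhds' (𝒰.map fun n => toWeakSpace ℝ C(K, ℝ) (x n))
    (Ultrafilter.mem_map.2 (Filter.univ_mem' hx))
  obtain ⟨s, -, hs⟩ := isCompact_univ.ultrafilter_le_nhds' (𝒰.map t) Filter.univ_mem
  obtain ⟨z, rfl⟩ := (toWeakSpace ℝ C(K, ℝ)).surjective y
  have hxz : ∀ u : K, Tendsto (fun n => x n u) 𝒰 (𝓝 (z u)) := fun u =>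
    ((WeakBilin.eval_continuous (topDualPairing ℝ C(K, ℝ)).flip
      (ContinuousMap.evalCLM ℝ u)).tendsto (toWeakSpace ℝ C(K, ℝ) z)).comp hy
  have hts : Tendsto t 𝒰 (𝓝 s) := hs
  -- Letting n, then m, tend to infinity leaves a gap of at least r; the opposite order gives 0.
  have h1 : ∀ m, r ≤ |z (t m) - z t₀| := fun m =>
    ge_of_tendsto ((hxz (t m)).sub (hxz t₀)).abs ((h𝒰 m).mono fun n hn => hlow m n hn.le)
  have h2 : r ≤ |z s - z t₀| :=
    ge_of_tendsto ((((z.continuous.tendsto s).comp hts).sub_const _).abs) (.of_forall h1)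
  have h3 : ∀ n : ℕ, |x n s - x n t₀| ≤ 1 / ((n : ℝ) + 1) := fun n =>
    le_of_tendsto (((((x n).continuous.tendsto s).comp hts).sub_const _).abs)
      ((h𝒰 n).mono fun m hm => hup n m hm)
  have h4 : |z s - z t₀| ≤ 0 :=
    le_of_tendsto_of_tendsto ((hxz s).sub (hxz t₀)).abs
      (tendsto_one_div_add_atTop_nhds_zero_nat.mono_left Nat.hyperfilter_le_atTop)
      (.of_forall h3)
  linarith

/-- If the property fails on E, recursion yields decreasing pairs (B, U). Each step picks t in U and
shrinks B so that all later averages separate t from t₀ by r, then shrinks U so that the current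
average barely varies on it. The images of the averages lie in a weakly compact set, contradicting
the double limit criterion. -/
theorem IsWeaklyCompactOperator.hasLocalEquicontinuityAt {T : Lp ℝ 1 μ →L[ℝ] C(K, ℝ)}
    (hT : IsWeaklyCompactOperator T) (t₀ : K) : HasLocalEquicontinuityAt T t₀ := by
  obtain ⟨C, hC, hTC⟩ := (isWeaklyCompactOperator_iff T).1 hT
  intro E hE hμE r hr
  by_contra! H
  let State := {p : Set Ω × Set K // p.1 ⊆ E ∧ MeasurableSet p.1 ∧ μ p.1 ≠ 0 ∧ p.2 ∈ 𝓝 t₀}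
  let avg : State → C(K, ℝ) := fun p => T (normalizedIndicator μ p.1.1 p.2.2.1)
  have step : ∀ (n : ℕ) (p : State), ∃ (t : K) (q : State), t ∈ p.1.2 ∧ q.1.1 ⊆ p.1.1 ∧
      q.1.2 ⊆ p.1.2 ∧ (∀ u ∈ q.1.2, |avg q u - avg q t₀| ≤ 1 / ((n : ℝ) + 1)) ∧
      ∀ q' : State, q'.1.1 ⊆ q.1.1 → r ≤ |avg q' t - avg q' t₀| := by
    rintro n ⟨⟨B, U⟩, hBE, hB, hμB, hU⟩
    obtain ⟨t, htU, ht⟩ := H B hBE hB hμB U hU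
    obtain ⟨B', hB'B, hB', hμB', hF⟩ := exists_apply_normalizedIndicator_ge hB (by simpa using ht)
    set x := T (normalizedIndicator μ B' hB')
    have hV : {u | |x u - x t₀| < 1 / ((n : ℝ) + 1)} ∈ 𝓝 t₀ :=
      (isOpen_lt (by fun_prop) (by fun_prop)).mem_nhds (by
        simp only [Set.mem_ofPred_eq, sub_self, abs_zero]; positivity)
    exact ⟨t, ⟨(B', U ∩ {u | |x u - x t₀| < 1 / ((n : ℝ) + 1)}), hB'B.trans hBE, hB', hμB',
      inter_mem hU hV⟩, htU, hB'B, Set.inter_subset_left, fun u hu => le_of_lt hu.2,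
      fun q' hq' => hF _ q'.2.2.1 hq' q'.2.2.2.1⟩
  choose t next h1 h2 h3 h4 h5 using step
  let p₀ : State := ⟨(E, Set.univ), subset_rfl, hE, hμE, univ_mem⟩
  let p : ℕ → State := fun n => Nat.rec p₀ next n
  have hpB : Antitone fun n => (p n).1.1 := antitone_nat_of_succ_le fun n => h2 n (p n)
  have hpU : Antitone fun n => (p n).1.2 := antitone_nat_of_succ_le fun n => h3 n (p n)
  refine false_of_separated_iterated_limits hC (x := fun n => avg (p (n + 1)))
    (t := fun n => t n (p n)) (t₀ := t₀) (fun n => hTC _ (norm_normalizedIndicator_le _)) hr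
    (fun m n hmn => h5 m (p m) (p (n + 1)) (hpB (Nat.succ_le_succ hmn)))
    (fun n m hnm => h4 n (p n) _ (hpU (Nat.succ_le_of_lt hnm) (h1 m (p m))))

end LocalEquicontinuity

/-! ### Exhausting a set by pieces of equicontinuity. -/

section Exhaustion

open Filter Topology

variable {Ω K : Type*} [MeasurableSpace Ω] {μ : Measure Ω} [IsFiniteMeasure μ]
  [TopologicalSpace K]

theorem HasLocalEquicontinuityAt.exists_setIntegral_gt {T : Lp ℝ 1 μ →L[ℝ] C(K, ℝ)} {t₀ : K}
    (hT : HasLocalEquicontinuityAt T t₀) {A : Set Ω} (hA : MeasurableSet A) {w : Ω → ℝ}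
    (hw : Integrable w μ) (hw0 : ∀ ω, 0 ≤ w ω) (hwA : ∀ ω ∈ A, 0 < w ω)
    {r η : ℝ} (hr : 0 < r) (hη : 0 < η) :
    ∃ B ⊆ A, MeasurableSet B ∧ (∃ U ∈ 𝓝 t₀, ∀ t ∈ U,
      ∀ᵐ ω ∂μ, ω ∈ B → |evalDensity T t ω - evalDensity T t₀ ω| ≤ r) ∧
      ∫ ω in A, w ω ∂μ - η < ∫ ω in B, w ω ∂μ := by
  let Good : Set Ω → Prop := fun B => B ⊆ A ∧ MeasurableSet B ∧ ∃ U ∈ 𝓝 t₀, ∀ t ∈ U,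
      ∀ᵐ ω ∂μ, ω ∈ B → |evalDensity T t ω - evalDensity T t₀ ω| ≤ r
  have good_union : ∀ B B', Good B → Good B' → Good (B ∪ B') := by
    rintro B B' ⟨h1, h2, U, hU, h3⟩ ⟨h1', h2', U', hU', h3'⟩
    refine ⟨Set.union_subset h1 h1', h2.union h2', U ∩ U', inter_mem hU hU', fun t ht => ?_⟩
    filter_upwards [h3 t ht.1, h3' t ht.2] with ω h h' hω
    exact hω.elim h h'
  have good_empty : Good ∅ := ⟨Set.empty_subset _, .empty, Set.univ, univ_mem, by simp⟩
  let s : Set ℝ := {x | ∃ B, Good B ∧ ∫ ω in B, w ω ∂μ = x}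
  have hbdd : BddAbove s := by
    refine ⟨∫ ω in A, w ω ∂μ, ?_⟩
    rintro _ ⟨B, hB, rfl⟩
    exact setIntegral_mono_set hw.integrableOn (.of_forall hw0) (.of_forall hB.1)
  have hne : s.Nonempty := ⟨_, ∅, good_empty, rfl⟩
  suffices h : ∫ ω in A, w ω ∂μ ≤ sSup s by
    obtain ⟨_, ⟨B, hB, rfl⟩, hlt⟩ := exists_lt_of_lt_csSup hne
      (show ∫ ω in A, w ω ∂μ - η < sSup s by linarith)
    exact ⟨B, hB.1, hB.2.1, hB.2.2, hlt⟩
  have hseq : ∀ n : ℕ, ∃ B, Good B ∧ sSup s - 1 / ((n : ℝ) + 1) < ∫ ω in B, w ω ∂μ := fun n => by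
    obtain ⟨_, ⟨B, hB, rfl⟩, hlt⟩ := exists_lt_of_lt_csSup hne
      (show sSup s - 1 / ((n : ℝ) + 1) < sSup s by
        have : (0 : ℝ) < 1 / ((n : ℝ) + 1) := by positivity
        linarith)
    exact ⟨B, hB, hlt⟩
  choose B hB hlt using hseq
  -- Infinitely many neighbourhoods need not intersect in one, so only finite unions of the B n are
  -- known to be good; hence the loss η. A non-null remainder would contain a further good piece of
  -- positive mass, exceeding the supremum.
  by_cases hE : μ (A \ ⋃ n, B n) = 0
  · have hgood : ∀ n, Good (Set.accumulate B n) := fun n => by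
      induction n with
      | zero => simpa using hB 0
      | succ n ih => rw [Set.accumulate_succ]; exact good_union _ _ ih (hB _)
    have hlim := tendsto_setIntegral_of_monotone (μ := μ) (f := w) (fun n => (hgood n).2.1)
      Set.monotone_accumulate hw.integrableOn
    have hle := le_of_tendsto hlim (.of_forall fun n => le_csSup hbdd ⟨_, hgood n, rfl⟩)
    refine le_trans (le_of_eq ?_) hle
    rw [Set.iUnion_accumulate]
    refine setIntegral_congr_set (Filter.EventuallyLE.antisymm ?_ ?_)
    · rw [ae_le_set]; exact hE
    · exact .of_forall (Set.iUnion_subset fun n => (hB n).1)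
  · exfalso
    obtain ⟨B', hB'E, hB', hμB', hU⟩ :=
      hT _ (hA.diff (.iUnion fun n => (hB n).2.1)) hE r hr
    have hpos : 0 < ∫ ω in B', w ω ∂μ := by
      rw [setIntegral_pos_iff_support_of_nonneg_ae (.of_forall hw0) hw.integrableOn]
      rw [Set.inter_eq_self_of_subset_right
        (show B' ⊆ Function.support w from fun ω hω => (hwA ω (hB'E hω).1).ne')]
      exact pos_iff_ne_zero.2 hμB'
    obtain ⟨n, hn⟩ := exists_nat_one_div_lt hpos
    have hdisj : Disjoint (B n) B' := Set.disjoint_left.2 fun ω h1 h2 =>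
      (hB'E h2).2 (Set.mem_iUnion_of_mem n h1)
    have hle := le_csSup hbdd ⟨_, good_union _ _ (hB n)
      ⟨hB'E.trans Set.sdiff_subset, hB', hU⟩, rfl⟩
    rw [setIntegral_union hdisj hB' hw.integrableOn hw.integrableOn] at hle
    linarith [hlt n]

end Exhaustion

/-! ### The perturbed operator and its kernel. -/

section Perturbation

variable {Ω K : Type*} [MeasurableSpace Ω] {μ : Measure Ω}
  [TopologicalSpace K] [CompactSpace K]

/-- The operator `T + u · (b - a T)`, where `a` and `b` act on `L₁(μ)` by multiplication and
integration respectively, and `u` acts on `C(K)` by multiplication. -/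
noncomputable def perturbation (T : Lp ℝ 1 μ →L[ℝ] C(K, ℝ)) (u : C(K, ℝ)) (a b : Lp ℝ ⊤ μ) :
    Lp ℝ 1 μ →L[ℝ] C(K, ℝ) :=
  T + (pairL1 b).smulRight u + (ContinuousLinearMap.mul ℝ C(K, ℝ) (-u)).comp (T.comp (mulL1 a))

theorem IsWeaklyCompactOperator.perturbation {T : Lp ℝ 1 μ →L[ℝ] C(K, ℝ)}
    (hT : IsWeaklyCompactOperator T) (u : C(K, ℝ)) (a b : Lp ℝ ⊤ μ) :
    IsWeaklyCompactOperator (perturbation T u a b) :=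
  (hT.add (isWeaklyCompactOperator_smulRight _ _)).add ((hT.comp_right _).comp_left _)

theorem integrable_coe_mul_of_bounded (f : Lp ℝ 1 μ) {k : Ω → ℝ} (hk : Measurable k) {C : ℝ}
    (hC : ∀ ω, |k ω| ≤ C) : Integrable (fun ω => f ω * k ω) μ :=
  (L1.integrable_coeFn f).mul_bdd hk.aestronglyMeasurable (.of_forall hC)

theorem IsBochnerRepresentable.perturbation {T : Lp ℝ 1 μ →L[ℝ] C(K, ℝ)}
    (hT : IsBochnerRepresentable T) (u : C(K, ℝ)) (a b : Lp ℝ ⊤ μ) :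
    IsBochnerRepresentable (perturbation T u a b) := by
  obtain ⟨h, hm, ⟨C, hC⟩, hT⟩ := hT
  obtain ⟨a', ham, ⟨Ca, ha⟩, haa⟩ := exists_bounded_measurable_ae_eq a
  obtain ⟨b', hbm, ⟨Cb, hb⟩, hbb⟩ := exists_bounded_measurable_ae_eq b
  refine ⟨fun ω => h ω + b' ω • u + a' ω • (-u * h ω), ?_, ⟨C + Cb * ‖u‖ + Ca * (‖u‖ * C), ?_⟩,
    fun f => ?_⟩
  · exact (hm.add (hbm.stronglyMeasurable.smul_const u)).add
      (ham.stronglyMeasurable.smul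
        ((ContinuousLinearMap.mul ℝ C(K, ℝ) (-u)).continuous.comp_stronglyMeasurable hm))
  · intro ω
    have hCa : 0 ≤ Ca := (abs_nonneg _).trans (ha ω)
    refine (norm_add₃_le).trans (add_le_add_three (hC ω) ?_ ?_)
    · rw [norm_smul]; exact mul_le_mul_of_nonneg_right (hb ω) (norm_nonneg _)
    · rw [norm_smul]
      refine mul_le_mul (ha ω) ((norm_mul_le _ _).trans ?_) (norm_nonneg _) hCa
      rw [norm_neg]
      exact mul_le_mul_of_nonneg_left (hC ω) (norm_nonneg _)
  · have hfb := integrable_coe_mul_of_bounded f hbm hb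
    have hfa := integrable_coe_mul_of_bounded f ham ha
    have i1 : Integrable (fun ω => f ω • h ω) μ :=
      (L1.integrable_coeFn f).smul_bdd C hm.aestronglyMeasurable (.of_forall hC)
    have i2 : Integrable (fun ω => (f ω * b' ω) • u) μ := hfb.smul_const u
    have i3 : Integrable (fun ω => (f ω * a' ω) • h ω) μ :=
      hfa.smul_bdd C hm.aestronglyMeasurable (.of_forall hC)
    have e2 : pairL1 b f • u = ∫ ω, (f ω * b' ω) • u ∂μ := by
      rw [integral_smul_const, pairL1_apply]
      congr 1
      apply integral_congr_ae
      filter_upwards [hbb] with ω h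
      rw [h, mul_comm]
    have e3 : -u * T (mulL1 a f) = ∫ ω, -u * ((f ω * a' ω) • h ω) ∂μ := by
      have : T (mulL1 a f) = ∫ ω, (f ω * a' ω) • h ω ∂μ := by
        rw [hT]
        apply integral_congr_ae
        filter_upwards [haa, coeFn_mulL1 a f] with ω h h'
        rw [h', h, mul_comm]
      rw [this]
      exact ((ContinuousLinearMap.mul ℝ C(K, ℝ) (-u)).integral_comp_comm i3).symm
    have i3' : Integrable (fun ω => -u * ((f ω * a' ω) • h ω)) μ :=
      (ContinuousLinearMap.mul ℝ C(K, ℝ) (-u)).integrable_comp i3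
    change T f + pairL1 b f • u + -u * T (mulL1 a f) = _
    rw [e2, e3, hT, ← integral_add i1 i2, ← integral_add (by exact i1.add i2) i3']
    congr 1
    ext1 ω
    simp only [smul_add, smul_smul, mul_smul_comm]

theorem perturbation_apply_sub [IsFiniteMeasure μ] (T : Lp ℝ 1 μ →L[ℝ] C(K, ℝ)) (u : C(K, ℝ))
    {a b : Lp ℝ ⊤ μ} {a' b' : Ω → ℝ} (ham : Measurable a') (hbm : Measurable b')
    (ha : ∀ ω, |a' ω| ≤ 1) (hb : ∀ ω, |b' ω| ≤ 1) (haa : a =ᵐ[μ] a') (hbb : b =ᵐ[μ] b')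
    (f : Lp ℝ 1 μ) (t : K) :
    (perturbation T u a b - T) f t
      = ∫ ω, f ω * (u t * (b' ω - a' ω * evalDensity T t ω)) ∂μ := by
  have hb1 := integrable_coe_mul_of_bounded f hbm hb
  have ha1 : Integrable (fun ω => f ω * (a' ω * evalDensity T t ω)) μ :=
    integrable_coe_mul_of_bounded f (ham.mul (measurable_evalDensity T t)) (C := 1 * ‖T‖)
      fun ω => by
        rw [abs_mul]
        exact mul_le_mul (ha ω) (abs_evalDensity_le T t ω) (abs_nonneg _) zero_le_one
  have e1 : pairL1 b f = ∫ ω, f ω * b' ω ∂μ := by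
    rw [pairL1_apply]
    apply integral_congr_ae
    filter_upwards [hbb] with ω h
    rw [h, mul_comm]
  have e2 : T (mulL1 a f) t = ∫ ω, f ω * (a' ω * evalDensity T t ω) ∂μ := by
    rw [apply_eq_integral_evalDensity]
    apply integral_congr_ae
    filter_upwards [haa, coeFn_mulL1 a f] with ω h h'
    rw [h', h]; ring
  have : (perturbation T u a b - T) f t = u t * (pairL1 b f - T (mulL1 a f) t) := by
    simp [perturbation]; ring
  rw [this, e1, e2, ← integral_sub hb1 ha1, ← integral_const_mul]
  congr 1
  ext1 ω
  ring

theorem opNorm_le_of_kernel_bound {R : Lp ℝ 1 μ →L[ℝ] C(K, ℝ)} {k : K → Ω → ℝ} {c : ℝ}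
    (hc : 0 ≤ c) (hk : ∀ t, ∀ᵐ ω ∂μ, |k t ω| ≤ c) (hR : ∀ f t, R f t = ∫ ω, f ω * k t ω ∂μ) :
    ‖R‖ ≤ c := by
  refine R.opNorm_le_bound hc fun f => (ContinuousMap.norm_le _ (by positivity)).2 fun t => ?_
  rw [hR, L1.norm_eq_integral_norm, ← integral_const_mul]
  refine norm_integral_le_of_norm_le ((L1.integrable_coeFn f).norm.const_mul c) ?_
  filter_upwards [hk t] with ω h
  rw [norm_mul, mul_comm]
  exact mul_le_mul_of_nonneg_right h (norm_nonneg _)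

end Perturbation

/-! ### Construction of the norm-attaining pair. -/

section NormAttainment

open Filter Topology

variable {Ω K : Type*} [MeasurableSpace Ω] {μ : Measure Ω} [IsFiniteMeasure μ]
  [TopologicalSpace K] [CompactSpace K] [T2Space K]

theorem exists_continuousMap_eq_one_of_mem_nhds {t₀ : K} {U : Set K} (hU : U ∈ 𝓝 t₀) :
    ∃ u : C(K, ℝ), u t₀ = 1 ∧ (∀ t, 0 ≤ u t ∧ u t ≤ 1) ∧ ∀ t ∉ U, u t = 0 := by
  obtain ⟨u, h0, h1, h⟩ := exists_continuous_zero_one_of_isClosed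
    (isOpen_interior (s := U)).isClosed_compl (isClosed_singleton (x := t₀))
    (Set.disjoint_singleton_right.2 fun h => h (mem_interior_iff_mem_nhds.2 hU))
  exact ⟨u, h1 rfl, h, fun t ht => h0 fun h => ht (interior_subset h)⟩

theorem exists_perturbation_norm_attaining {ε : ℝ} (hε0 : 0 < ε) (hε1 : ε < 1)
    {T : Lp ℝ 1 μ →L[ℝ] C(K, ℝ)} (hT : ‖T‖ = 1) {f : Lp ℝ 1 μ} (hf : ‖f‖ = 1) {t₀ : K}
    (hTf : 1 - ε ^ 2 / 6 < |T f t₀|) (hloc : HasLocalEquicontinuityAt T t₀) :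
    ∃ (u : C(K, ℝ)) (a b : Lp ℝ ⊤ μ) (g : Lp ℝ 1 μ),
      ‖perturbation T u a b‖ = 1 ∧ ‖g‖ = 1 ∧ ‖perturbation T u a b g‖ = 1 ∧
        ‖perturbation T u a b - T‖ < ε ∧ ‖f - g‖ < ε := by
  set ρ := evalDensity T t₀ with hρ
  have hρ1 : ∀ t ω, |evalDensity T t ω| ≤ 1 := fun t ω => hT ▸ abs_evalDensity_le T t ω
  obtain ⟨σ, hσ, hσT⟩ : ∃ σ : ℝ, |σ| = 1 ∧ σ * T f t₀ = |T f t₀| := by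
    rcases le_total 0 (T f t₀) with h | h
    · exact ⟨1, by simp, by rw [abs_of_nonneg h, one_mul]⟩
    · exact ⟨-1, by simp, by rw [abs_of_nonpos h, neg_one_mul]⟩
  have hfm : Measurable f := (Lp.stronglyMeasurable f).measurable
  have hfi : Integrable f μ := L1.integrable_coeFn f
  have hwi : Integrable (fun ω => |f ω|) μ := hfi.norm
  have hw1 : ∫ ω, |f ω| ∂μ = 1 := by rw [← hf, L1.norm_eq_integral_norm]; rfl
  set s : Ω → ℝ := fun ω => σ * (f ω / |f ω|) with hs
  have hsm : Measurable s := by fun_prop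
  have hs0 : ∀ ω, f ω ≠ 0 → |s ω| = 1 := fun ω h => by
    rw [hs, abs_mul, hσ, one_mul, abs_div, abs_abs, div_self (abs_ne_zero.2 h)]
  have hs1 : ∀ ω, |s ω| ≤ 1 := fun ω => by
    by_cases h : f ω = 0
    · simp [hs, h]
    · exact (hs0 ω h).le
  have hws : ∀ ω, |f ω| * s ω = σ * f ω := fun ω => by
    by_cases h : f ω = 0
    · simp [h]
    · have := abs_ne_zero.2 h
      simp only [hs]; field_simp
  have hfs : ∀ ω, f ω * s ω = σ * |f ω| := fun ω => by
    rw [hs, mul_left_comm, ← mul_div_assoc, ← abs_mul_abs_self, mul_self_div_self]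
  set A : Set Ω := {ω | 1 - ε / 2 < s ω * ρ ω}
  have hA : MeasurableSet A :=
    measurableSet_lt measurable_const (hsm.mul (measurable_evalDensity T t₀))
  have hA0 : ∀ ω ∈ A, f ω ≠ 0 := fun ω hω h => by
    have : 1 - ε / 2 < s ω * ρ ω := hω
    simp [hs, h] at this
    linarith
  -- Bounding s ρ by 1 on A and by 1 - ε/2 elsewhere gives 1 - ε²/6 < (1 - ε/2) + (ε/2) ∫_A |f|.
  have hAint : 1 - ε / 3 < ∫ ω in A, |f ω| ∂μ := by
    have h1 : σ * T f t₀ = ∫ ω, |f ω| * (s ω * ρ ω) ∂μ := by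
      rw [apply_eq_integral_evalDensity, ← integral_const_mul]
      congr 1
      ext1 ω
      rw [← mul_assoc, ← mul_assoc, hws]
    have h2 : ∫ ω, |f ω| * (s ω * ρ ω) ∂μ
        ≤ ∫ ω, ((1 - ε / 2) * |f ω| + (ε / 2) * A.indicator (fun ω => |f ω|) ω) ∂μ := by
      refine integral_mono ?_ ((hwi.const_mul _).add ((hwi.indicator hA).const_mul _)) fun ω => ?_
      · refine hwi.mul_bdd (c := 1) (hsm.mul
          (measurable_evalDensity T t₀)).aestronglyMeasurable (.of_forall fun ω => ?_)
        rw [norm_mul]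
        exact mul_le_one₀ (hs1 ω) (norm_nonneg _) (hρ1 t₀ ω)
      · have h3 : s ω * ρ ω ≤ 1 := (le_abs_self _).trans (by
          rw [abs_mul]; exact mul_le_one₀ (hs1 ω) (abs_nonneg _) (hρ1 t₀ ω))
        by_cases h : ω ∈ A
        · simp only [Set.indicator_of_mem h]
          nlinarith [abs_nonneg (f ω)]
        · have h4 : s ω * ρ ω ≤ 1 - ε / 2 := not_lt.1 h
          simp only [Set.indicator_of_notMem h]
          nlinarith [abs_nonneg (f ω)]
    rw [integral_add (hwi.const_mul _) ((hwi.indicator hA).const_mul _), integral_const_mul,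
      integral_const_mul, integral_indicator hA, hw1, ← h1, hσT] at h2
    by_contra! h
    nlinarith
  -- The loss η = ε/6 leaves mass m > 1 - ε/2, and r = ε/4 gives ‖S - T‖ ≤ ε/2 + ε/4.
  obtain ⟨B, hBA, hB, ⟨U, hU, hUB⟩, hBint⟩ := hloc.exists_setIntegral_gt hA hwi
    (fun ω => abs_nonneg _) (fun ω hω => abs_pos.2 (hA0 ω hω))
    (r := ε / 4) (η := ε / 6) (by positivity) (by positivity)
  set m : ℝ := ∫ ω in B, |f ω| ∂μ with hm
  have hm_gt : 1 - ε / 2 < m := by linarith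
  have hm_pos : 0 < m := by linarith
  have hm_le : m ≤ 1 := hw1 ▸ setIntegral_le_integral hwi (.of_forall fun ω => abs_nonneg _)
  obtain ⟨u, hu0, hu, huU⟩ := exists_continuousMap_eq_one_of_mem_nhds hU
  set a' : Ω → ℝ := B.indicator 1 with ha'
  set b' : Ω → ℝ := B.indicator s with hb'
  have ham : Measurable a' := measurable_one.indicator hB
  have hbm : Measurable b' := hsm.indicator hB
  have ha1 : ∀ ω, |a' ω| ≤ 1 := fun ω => by by_cases h : ω ∈ B <;> simp [ha', h]
  have hb1 : ∀ ω, |b' ω| ≤ 1 := fun ω => by by_cases h : ω ∈ B <;> simp [hb', h, hs1]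
  have haL : MemLp a' ⊤ μ := memLp_top_of_bound ham.aestronglyMeasurable 1 (.of_forall ha1)
  have hbL : MemLp b' ⊤ μ := memLp_top_of_bound hbm.aestronglyMeasurable 1 (.of_forall hb1)
  set g : Lp ℝ 1 μ := m⁻¹ • mulL1 haL.toLp f with hg
  have hga : g =ᵐ[μ] fun ω => m⁻¹ * (a' ω * f ω) := by
    filter_upwards [Lp.coeFn_smul m⁻¹ (mulL1 haL.toLp f), coeFn_mulL1 haL.toLp f,
      haL.coeFn_toLp] with ω h1 h2 h3
    rw [h1, Pi.smul_apply, h2, h3, smul_eq_mul]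
  set S := perturbation T u haL.toLp hbL.toLp with hS
  have hsub : ∀ h t, (S - T) h t
      = ∫ ω, h ω * (u t * (b' ω - a' ω * evalDensity T t ω)) ∂μ := fun h t =>
    perturbation_apply_sub T u ham hbm ha1 hb1 haL.coeFn_toLp hbL.coeFn_toLp h t
  have hk1 : ∀ t ω, |u t * (b' ω - a' ω * evalDensity T t ω)| ≤ 2 := fun t ω => by
    rw [abs_mul, abs_of_nonneg (hu t).1]
    have h1 : |a' ω * evalDensity T t ω| ≤ 1 := by
      rw [abs_mul]; exact mul_le_one₀ (ha1 ω) (abs_nonneg _) (hρ1 t ω)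
    have h2 := abs_sub (b' ω) (a' ω * evalDensity T t ω)
    have h3 := hb1 ω
    nlinarith [hu t, abs_nonneg (b' ω - a' ω * evalDensity T t ω)]
  have hSk : ∀ h t, S h t = ∫ ω, h ω *
      (evalDensity T t ω + u t * (b' ω - a' ω * evalDensity T t ω)) ∂μ := fun h t => by
    have h1 : S h t = T h t + (S - T) h t := by simp
    have h2 := integrable_coe_mul_of_bounded h (measurable_evalDensity T t) (hρ1 t)
    have h3 : Integrable (fun ω => h ω * (u t * (b' ω - a' ω * evalDensity T t ω))) μ :=
      integrable_coe_mul_of_bounded h ((hbm.sub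
        (ham.mul (measurable_evalDensity T t))).const_mul _) (hk1 t)
    rw [h1, hsub, apply_eq_integral_evalDensity, ← integral_add h2 h3]
    congr 1
    ext1 ω
    ring
  have hSle : ‖S‖ ≤ 1 := by
    refine opNorm_le_of_kernel_bound zero_le_one (fun t => .of_forall fun ω => ?_) hSk
    have h1 := abs_le.1 (hρ1 t ω)
    have h2 := abs_le.1 (hs1 ω)
    have h3 := hu t
    by_cases h : ω ∈ B
    · simp only [ha', hb', Set.indicator_of_mem h, Pi.one_apply, one_mul]
      rw [abs_le]
      constructor <;> nlinarith
    · simpa [ha', hb', h] using hρ1 t ω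
  have hST : ‖S - T‖ ≤ 3 * ε / 4 := by
    refine opNorm_le_of_kernel_bound (by positivity) (fun t => ?_) hsub
    by_cases ht : t ∈ U
    · filter_upwards [hUB t ht] with ω hω
      by_cases h : ω ∈ B
      · simp only [ha', hb', Set.indicator_of_mem h, Pi.one_apply, one_mul]
        have h1 := hω h
        -- Since s = ±1 on B, s - ρ = s (1 - s ρ), and 1 - s ρ lies in [0, ε/2) by the choice of A.
        have h2 : |s ω - ρ ω| ≤ ε / 2 := by
          have hss : s ω * s ω = 1 := by
            rw [← abs_mul_abs_self, hs0 ω (hA0 ω (hBA h)), one_mul]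
          have h3 : s ω - ρ ω = s ω * (1 - s ω * ρ ω) := by
            rw [mul_sub, ← mul_assoc, hss]; ring
          have h4 : s ω * ρ ω ≤ 1 := (le_abs_self _).trans (by
            rw [abs_mul]; exact mul_le_one₀ (hs1 ω) (abs_nonneg _) (hρ1 t₀ ω))
          have h5 : 1 - ε / 2 < s ω * ρ ω := hBA h
          rw [h3, abs_mul, hs0 ω (hA0 ω (hBA h)), one_mul, abs_of_nonneg (by linarith)]
          linarith
        have h3 := abs_sub_le (s ω) (ρ ω) (evalDensity T t ω)
        rw [abs_sub_comm (ρ ω)] at h3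
        rw [abs_mul, abs_of_nonneg (hu t).1]
        nlinarith [hu t, abs_nonneg (s ω - evalDensity T t ω)]
      · simp [ha', hb', h]; positivity
    · refine .of_forall fun ω => ?_
      rw [huU t ht, zero_mul, abs_zero]; positivity
  have hgnorm : ‖g‖ = 1 := by
    rw [L1.norm_eq_integral_norm]
    have : ∫ ω, ‖g ω‖ ∂μ = ∫ ω, m⁻¹ * B.indicator (fun ω => |f ω|) ω ∂μ := by
      apply integral_congr_ae
      filter_upwards [hga] with ω h
      rw [h, Real.norm_eq_abs, abs_mul, abs_of_pos (inv_pos.2 hm_pos)]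
      by_cases h : ω ∈ B <;> simp [ha', h]
    rw [this, integral_const_mul, integral_indicator hB, ← hm, inv_mul_cancel₀ hm_pos.ne']
  have hSg : S g t₀ = σ := by
    have : S g t₀ = ∫ ω, (m⁻¹ * σ) * B.indicator (fun ω => |f ω|) ω ∂μ := by
      rw [hSk]
      apply integral_congr_ae
      filter_upwards [hga] with ω h
      rw [h, hu0]
      by_cases h : ω ∈ B
      · simp only [ha', hb', Set.indicator_of_mem h, Pi.one_apply, one_mul]
        linear_combination m⁻¹ * hfs ω
      · simp [ha', h]
    rw [this, integral_const_mul, integral_indicator hB, ← hm]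
    field_simp
  have hSg_le : ‖S g‖ ≤ ‖S‖ := by simpa [hgnorm] using S.le_opNorm g
  have hSg_ge : 1 ≤ ‖S g‖ := by
    have := (S g).norm_coe_le_norm t₀
    rwa [hSg, Real.norm_eq_abs, hσ] at this
  refine ⟨u, haL.toLp, hbL.toLp, g, le_antisymm hSle (hSg_ge.trans hSg_le), hgnorm,
    le_antisymm (hSg_le.trans hSle) hSg_ge, hST.trans_lt (by linarith), ?_⟩
  rw [L1.norm_eq_integral_norm]
  have hm_inv : 1 ≤ m⁻¹ := (one_le_inv₀ hm_pos).2 hm_le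
  -- The distance is (1 - m) off B plus (1/m - 1) m on B, that is 2 (1 - m) < ε.
  have : ∫ ω, ‖(f - g : Lp ℝ 1 μ) ω‖ ∂μ
      = ∫ ω, (|f ω| + (m⁻¹ - 2) * B.indicator (fun ω => |f ω|) ω) ∂μ := by
    apply integral_congr_ae
    filter_upwards [hga, Lp.coeFn_sub f g] with ω h1 h2
    rw [h2, Pi.sub_apply, h1, Real.norm_eq_abs]
    by_cases h : ω ∈ B
    · simp only [ha', Set.indicator_of_mem h, Pi.one_apply, one_mul]
      rw [show f ω - m⁻¹ * f ω = -((m⁻¹ - 1) * f ω) by ring, abs_neg, abs_mul,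
        abs_of_nonneg (by linarith)]
      ring
    · simp [ha', h]
  rw [this, integral_add hwi ((hwi.indicator hB).const_mul _), integral_const_mul,
    integral_indicator hB, ← hm, hw1, sub_mul, inv_mul_cancel₀ hm_pos.ne']
  linarith

end NormAttainment

theorem corollary5p3 {Ω K : Type*} [MeasurableSpace Ω] (μ : Measure Ω) [IsFiniteMeasure μ]
    [TopologicalSpace K] [CompactSpace K] [T2Space K]
    (ε : ℝ) (hε0 : 0 < ε) (hε1 : ε < 1)
    (T : Lp ℝ 1 μ →L[ℝ] C(K, ℝ)) (hT : ‖T‖ = 1)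
    (f : Lp ℝ 1 μ) (hf : ‖f‖ = 1) (hTf : 1 - ε ^ 2 / 6 < ‖T f‖) :
    (IsBochnerRepresentable T →
      ∃ (S : Lp ℝ 1 μ →L[ℝ] C(K, ℝ)) (g : Lp ℝ 1 μ),
        IsBochnerRepresentable S ∧ ‖S‖ = 1 ∧ ‖g‖ = 1 ∧ ‖S g‖ = 1 ∧
          ‖S - T‖ < ε ∧ ‖f - g‖ < ε) ∧
    (IsWeaklyCompactOperator T →
      ∃ (S : Lp ℝ 1 μ →L[ℝ] C(K, ℝ)) (g : Lp ℝ 1 μ),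
        IsWeaklyCompactOperator S ∧ ‖S‖ = 1 ∧ ‖g‖ = 1 ∧ ‖S g‖ = 1 ∧
          ‖S - T‖ < ε ∧ ‖f - g‖ < ε) := by
  obtain ⟨t₀, ht₀⟩ : ∃ t₀, 1 - ε ^ 2 / 6 < |T f t₀| := by
    by_contra! h
    exact hTf.not_ge ((ContinuousMap.norm_le _ (by nlinarith)).2 h)
  constructor <;> intro h
  · obtain ⟨u, a, b, g, H⟩ := exists_perturbation_norm_attaining hε0 hε1 hT hf ht₀
      (h.hasLocalEquicontinuityAt t₀)
    exact ⟨_, g, h.perturbation u a b, H⟩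
  · obtain ⟨u, a, b, g, H⟩ := exists_perturbation_norm_attaining hε0 hε1 hT hf ht₀
      (h.hasLocalEquicontinuityAt t₀)
    exact ⟨_, g, h.perturbation u a b, H⟩
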